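/- Setting. Let $T\ge 1$ be the number of time slots. A service $(E,m)$, with nonnegative integers $E\le mT$, asks for $E$ units of energy in total and at most $m$ units per slot. Let $\mathcal C=\{(E^1,m^1),\dots,(E^n,m^n)\}$ be a finite collection (with repetitions allowed) of services, $\mathbf y=(y_1,\dots,y_T)$ the day-ahead energy and $\mathbf r=(r_1,\dots,r_T)$ a realization of the random renewable supply $\mathbf R$, all with nonnegative integer entries, and let $c^{rt}\ge 0$ be the real-time price of a unit of energy. A purchase policy $g$ chooses $a_t=g_t(\mathcal C,\mathbf y,r_1,\dots,r_t)\ge 0$ and an allocation policy $h$ chooses $u^i_t=h^i_t(\mathcal C,\mathbf y,r_1,\dots,r_t)$; the constraints are $$\sum_{t=1}^T u^i_t=E^i,\qquad u^i_t\in\{0,1,\dots,m^i\},\qquad \sum_{i=1}^n u^i_t\le y_t+r_t+a_t,\tag{1}$$ and $V(\mathcal C,\mathbf y)=\min_{g,h}c^{rt}\,\mathbb E\big[\sum_{t}g_t(\mathcal C,\mathbf y,R_1,\dots,R_t)\big]$ over all pairs of policies that satisfy (1) for (almost) every realization of $\mathbf R$. For $E=km+\ell$, $0\le\ell<m$, the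 unit-rate decomposition $\mathcal D(E,m)$ consists of $m$ services of rate $1$, of which $\ell$ have energy $k+1$ and $m-\ell$ have energy $k$ (it is empty if $m=0$), and $\mathcal D(\mathcal C)=\bigcup_i\mathcal D(E^i,m^i)=\{(e^1,1),\dots,(e^N,1)\}$, as a union with multiplicities. Put $d_t=\#\{j: e^j\ge t\}$ for $1\le t\le T$. Let $\mathbf a^{\downarrow}$ be the non-increasing rearrangement of $\mathbf a$, and for $k$-dimensional vectors write $\mathbf a\prec^w\mathbf b$ if $\sum_{s=t}^k a^{\downarrow}_s\le\sum_{s=t}^k b^{\downarrow}_s$ for $t=1,\dots,k$. The policy $g^*$ buys in slot $t$ the least $a_t\ge 0$ with $$(d_{T-t+1},\dots,d_T)\prec^w(y_1+r_1+a_1,\dots,y_t+r_t+a_t),$$ where $a_1,\dots,a_{t-1}$ are the earlier purchases under $g^*$. A least-laxity-first (LLF) allocation of a supply $\mathbf q$ to $\mathcal D(\mathcal C)$ ranks, in each slot $t$, the unit-rate services by increasing laxity $T-t+1-\big(e^j-\sum_{s<t}\nu^j_s\big)$ (ties broken arbitrarily), and sets $\nu^j_t=1$ if the rank of $j$ (counted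 from $1$) is at most $q_t$ and $e^j-\sum_{s<t}\nu^j_s>0$, and $\nu^j_t=0$ otherwise. Theorem. The policy $g^*$ is well defined (each minimum is attained, at a nonnegative integer, and $a_1=(d_T-y_1-r_1)^+$) and causal, and: 1. For every $\mathbf r$, the total supply $q_t=y_t+r_t+g^*_t(\mathcal C,\mathbf y,r_1,\dots,r_t)$ satisfies $\mathbf d\prec^w\mathbf q$. 2. For every $\mathbf r$ and every LLF allocation $(\nu^j_t)$ of $\mathbf q$ to $\mathcal D(\mathcal C)$, the allocations $u^i_t$, obtained by summing $\nu^j_t$ over the unit-rate services $j$ in $\mathcal D(E^i,m^i)$, satisfy (1) with the purchases $a_t=g^*_t$. The LLF allocations can be chosen causally. 3. For every $\mathbf r$, with $\mathbf p=\mathbf y+\mathbf r$, $$\sum_{t=1}^T g^*_t(\mathcal C,\mathbf y,r_1,\dots,r_t)=L(\mathcal C,\mathbf y,\mathbf r):=\Big[\max_{1\le t\le T}\sum_{s=t}^T(d_s-p^{\downarrow}_s)\Big]^+,$$ and any purchases $a_t\ge 0$ for which some allocation satisfies (1) have $\sum_t a_t\ge L(\mathcal C,\mathbf y,\mathbf r)$.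 Hence $g^*$, with any causal LLF allocation, is optimal: it satisfies the constraints, attains the minimum $V(\mathcal C,\mathbf y)$, and $V(\mathcal C,\mathbf y)=c^{rt}\,\mathbb E[L(\mathcal C,\mathbf y,\mathbf R)]$, where the expectation is finite. -/

import Mathlib

open MeasureTheory

namespace RateService

/-! Time slots are `Fin T`; the element `t : Fin T` is slot number `t + 1`. -/

/-- A rate-constrained service: `energy` units of energy over the delivery period,
at most `rate` units per slot. -/
structure Service where
  energy : ℕ
  rate : ℕ

/-- Non-increasing rearrangement of a real vector. -/
noncomputable def decr {k : ℕ} (a : Fin k → ℝ) : Fin k → ℝ :=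
  fun i => a (Tuple.sort a (Fin.rev i))

/-- The relation `a ≺ʷ b`: every tail sum of the non-increasing rearrangement of `a`
is at most the corresponding tail sum for `b`. -/
def WeakMaj {k : ℕ} (a b : Fin k → ℝ) : Prop :=
  ∀ t : Fin k, ∑ s ∈ Finset.Ici t, decr a s ≤ ∑ s ∈ Finset.Ici t, decr b s

/-- `u i t` delivers every service of `C` in full, within its rate constraint,
out of the available supply `q`. -/
structure Meets {n T : ℕ} (C : Fin n → Service) (q : Fin T → ℝ) (u : Fin n → Fin T → ℕ) :
    Prop where
  energy_eq : ∀ i, ∑ t, u i t = (C i).energy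
  rate_le : ∀ i t, u i t ≤ (C i).rate
  supply_le : ∀ t, ((∑ i, u i t : ℕ) : ℝ) ≤ q t

/-- Index set of the unit-rate decomposition of the collection `C`: service `i` is split into
`(C i).rate` services of rate one. -/
abbrev UnitIndex {n : ℕ} (C : Fin n → Service) : Type :=
  (i : Fin n) × Fin (C i).rate

/-- Energy (duration) requested by a unit-rate service. With `E = k m + l`, `l < m`, the first `l`
parts of `(E, m)` request `k + 1` and the others request `k`. -/
def unitEnergy {n : ℕ} (C : Fin n → Service) (j : UnitIndex C) : ℕ :=
  if (j.2 : ℕ) < (C j.1).energy % (C j.1).rate then (C j.1).energy / (C j.1).rate + 1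
  else (C j.1).energy / (C j.1).rate

/-- Demand-duration vector: the number of unit-rate services whose requested duration is at least
the number of the slot. -/
def demand {n : ℕ} (C : Fin n → Service) (T : ℕ) (t : Fin T) : ℝ :=
  ((Finset.univ.filter fun j : UnitIndex C => (t : ℕ) + 1 ≤ unitEnergy C j).card : ℝ)

/-- Supply available without real-time purchases. -/
def baseSupply {T : ℕ} (y r : Fin T → ℕ) (t : Fin T) : ℝ := (y t : ℝ) + (r t : ℝ)

/-- The vector of the last entries of `d`, as many as there are slots up to and including `t`. -/
def lastEntries {T : ℕ} (d : Fin T → ℝ) (t : Fin T) : Fin ((t : ℕ) + 1) → ℝ :=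
  fun i => d ⟨T - 1 - (t : ℕ) + (i : ℕ), by have := t.isLt; have := i.isLt; omega⟩

/-- Supply in the slots up to and including `t`, when the purchases are `a` before slot `t` and `x`
in slot `t`. -/
noncomputable def partialSupply {T : ℕ} (p a : Fin T → ℝ) (t : Fin T) (x : ℝ) :
    Fin ((t : ℕ) + 1) → ℝ :=
  fun s => if (s : ℕ) < (t : ℕ) then p (Fin.castLE t.isLt s) + a (Fin.castLE t.isLt s) else p t + x

/-- Purchases of the least energy, slot after slot, for a demand-duration vector `d` and a base
supply `p`. -/
noncomputable def leastPurchase {T : ℕ} (d p : Fin T → ℝ) (t : Fin T) : ℝ :=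
  sInf {x : ℝ | 0 ≤ x ∧ WeakMaj (lastEntries d t)
    (partialSupply p (fun s => if _h : s < t then leastPurchase d p s else 0) t x)}
termination_by (t : ℕ)

/-- The real-time purchase policy `g*`. -/
noncomputable def gStar {n T : ℕ} (C : Fin n → Service) (y r : Fin T → ℕ) : Fin T → ℝ :=
  leastPurchase (demand C T) (baseSupply y r)

/-- Energy still needed by a unit-rate service at the beginning of slot `t`. -/
def remaining {J : Type} {T : ℕ} (E : J → ℕ) (ν : J → Fin T → ℕ) (t : Fin T) (j : J) : ℤ :=
  (E j : ℤ) - ∑ s ∈ Finset.Iio t, (ν j s : ℤ)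

/-- Laxity of a unit-rate service at the beginning of slot `t`: number of remaining slots
(including `t`) minus remaining energy. -/
def laxity {J : Type} {T : ℕ} (E : J → ℕ) (ν : J → Fin T → ℕ) (t : Fin T) (j : J) : ℤ :=
  ((T : ℤ) - (t : ℕ)) - remaining E ν t j

/-- `ν` is a least-laxity-first allocation of the supply `q` to the unit-rate services with
energies `E`: in every slot the services are ranked by laxity (ties are broken arbitrarily), and
those of rank at most `q t` which still need energy get one unit. -/
def IsLLF {J : Type} [Fintype J] {T : ℕ} (E : J → ℕ) (q : Fin T → ℝ) (ν : J → Fin T → ℕ) : Prop :=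
  ∀ t : Fin T, ∃ π : J ≃ Fin (Fintype.card J),
    (∀ j k, π j < π k → laxity E ν t j ≤ laxity E ν t k) ∧
    (∀ j, (((π j : ℕ) + 1 : ℝ) ≤ q t ∧ 0 < remaining E ν t j) → ν j t = 1) ∧
    (∀ j, ¬ (((π j : ℕ) + 1 : ℝ) ≤ q t ∧ 0 < remaining E ν t j) → ν j t = 0)

/-- Allocation to the services of `C` obtained by adding up the allocations to their unit-rate
parts. -/
def bundle {n T : ℕ} {C : Fin n → Service} (ν : UnitIndex C → Fin T → ℕ) (i : Fin n) (t : Fin T) :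
    ℕ :=
  ∑ j : Fin (C i).rate, ν ⟨i, j⟩ t

/-- The decision in each slot depends on the renewable supply up to that slot only. -/
def Causal {T : ℕ} {α : Type} (f : (Fin T → ℕ) → Fin T → α) : Prop :=
  ∀ (t : Fin T) (r r' : Fin T → ℕ), (∀ s ≤ t, r s = r' s) → f r t = f r' t

/-- `L(C, y, r)`: the positive part of the largest tail deficit of the supply-duration vector. -/
noncomputable def gap {n T : ℕ} (C : Fin n → Service) (y r : Fin T → ℕ) : ℝ :=
  max (⨆ t : Fin T, ∑ s ∈ Finset.Ici t, (demand C T s - decr (baseSupply y r) s)) 0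

/-- Admissible pairs of a purchase policy `g` and an allocation policy `h`, for a random renewable
supply `R`: both are causal, purchases are nonnegative, and all services are
delivered almost surely. -/
structure Admissible {Ω : Type*} [MeasurableSpace Ω] (P : Measure Ω) {n T : ℕ}
    (C : Fin n → Service) (y : Fin T → ℕ) (R : Ω → Fin T → ℕ)
    (g : (Fin T → ℕ) → Fin T → ℝ) (h : (Fin T → ℕ) → Fin n → Fin T → ℕ) : Prop where
  causal_purchase : Causal g
  nonneg_purchase : ∀ r t, 0 ≤ g r t
  causal_allocation : ∀ i, Causal fun r => h r i
  meets : ∀ᵐ ω ∂P, Meets C (fun t => baseSupply y (R ω) t + g (R ω) t) (h (R ω))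

/-- Expected cost of the purchase policy `g` at the real-time price `c`; it is infinite if the
expected purchase is infinite and `c > 0`. -/
noncomputable def expectedCost {Ω : Type*} [MeasurableSpace Ω] (P : Measure Ω) {T : ℕ} (c : ℝ)
    (R : Ω → Fin T → ℕ) (g : (Fin T → ℕ) → Fin T → ℝ) : ENNReal :=
  ENNReal.ofReal c * ∫⁻ ω, ENNReal.ofReal (∑ t, g (R ω) t) ∂P

/-- `V(C, y)`: optimal value of the expected real-time cost over all admissible policies. -/
noncomputable def optimalCost {Ω : Type*} [MeasurableSpace Ω] (P : Measure Ω) {n T : ℕ} (c : ℝ)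
    (C : Fin n → Service) (y : Fin T → ℕ) (R : Ω → Fin T → ℕ) : ENNReal :=
  sInf {v | ∃ (g : (Fin T → ℕ) → Fin T → ℝ) (h : (Fin T → ℕ) → Fin n → Fin T → ℕ),
    Admissible P C y R g h ∧ v = expectedCost P c R g}

end RateService

/-! For a non-increasing `d`, the relation `WeakMaj d q` says that every set `S` of slots has supply
at least `tailSum d S.card` (`weakMaj_iff`). For the demand vector this bound is the energy that the
unit-rate services cannot receive outside `S` (`tailSum_demand`), so the relation is necessary for
any delivery (`Meets.tailSum_le`). It is sufficient as well: least-laxity-first keeps the same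
inequalities valid for the remaining slots and energies (`IsLLF.sum_eq`).

In slot `t` the policy enforces the inequalities for the sets of slots up to `t`; as `t` runs
through all slots, every set is covered. A nonzero purchase in slot `t` makes an inequality for some
set containing `t` tight (`leastPurchase_spec`). Since `S ↦ tailSum d S.card` is supermodular and
supply is additive, tight sets are closed under union (`tailSum_union_eq_sum`), so a single tight
set contains all slots with a purchase. Its deficit before purchases equals the total purchase
(`exists_sum_leastPurchase_eq`). The largest deficit over all sets is `gap`, which is also a lower
bound for every feasible purchase. The causal policy is thus optimal for each realization
separately, and taking expectations gives the optimal cost. -/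

namespace RateService

/-! ### Weak majorization as a family of inequalities indexed by sets -/

/-- Sum of the last `m` entries of `d`. -/
def tailSum {k : ℕ} (d : Fin k → ℝ) (m : ℕ) : ℝ :=
  ∑ i ∈ Finset.range m, if h : i < k then d ⟨k - 1 - i, by omega⟩ else 0

@[simp] lemma tailSum_zero {k : ℕ} (d : Fin k → ℝ) : tailSum d 0 = 0 := by
  simp [tailSum]

lemma sum_Ici_eq_tailSum {k : ℕ} (d : Fin k → ℝ) (t : Fin k) :
    ∑ s ∈ Finset.Ici t, d s = tailSum d (k - t) := by
  unfold tailSum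
  refine Finset.sum_bij (fun s _ => k - 1 - (s : ℕ)) ?_ ?_ ?_ ?_
  · intro s hs
    have := Fin.le_def.1 (Finset.mem_Ici.1 hs)
    simp only [Finset.mem_range]
    omega
  · intro a _ b _ hab
    ext
    have := a.isLt
    have := b.isLt
    omega
  · intro i hi
    have := Finset.mem_range.1 hi
    refine ⟨⟨k - 1 - i, by omega⟩, ?_, ?_⟩
    · simp only [Finset.mem_Ici, Fin.le_def]
      omega
    · simp only
      omega
  · intro s _
    have := s.isLt
    rw [dif_pos (by omega)]
    congr 1
    ext
    simp only
    omega

/-- Convexity in the number of entries: counted from the end, the `a` entries after the first `n`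
lie further left than those after the first `m`, hence are at least as large. -/
lemma tailSum_supermodular {k : ℕ} {d : Fin k → ℝ} (hd : Antitone d) {m n a : ℕ} (hmn : m ≤ n)
    (hn : n + a ≤ k) : tailSum d (m + a) + tailSum d n ≤ tailSum d (n + a) + tailSum d m := by
  have h : ∑ i ∈ Finset.range a, (if h : m + i < k then d ⟨k - 1 - (m + i), by omega⟩ else 0) ≤
      ∑ i ∈ Finset.range a, if h : n + i < k then d ⟨k - 1 - (n + i), by omega⟩ else 0 := by
    refine Finset.sum_le_sum fun i hi => ?_
    have := Finset.mem_range.1 hi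
    rw [dif_pos (by omega), dif_pos (by omega)]
    apply hd
    simp only [Fin.le_def]
    omega
  simp only [tailSum, Finset.sum_range_add]
  linarith

/-- The permutation that lists a vector in non-increasing order. -/
noncomputable def decrPerm {k : ℕ} (a : Fin k → ℝ) : Equiv.Perm (Fin k) :=
  Fin.revPerm.trans (Tuple.sort a)

lemma decr_eq_apply_decrPerm {k : ℕ} (a : Fin k → ℝ) (i : Fin k) :
    decr a i = a (decrPerm a i) := rfl

lemma antitone_decr {k : ℕ} (a : Fin k → ℝ) : Antitone (decr a) := fun _ _ h =>
  Tuple.monotone_sort a (Fin.rev_le_rev.2 h)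

lemma decr_of_antitone {k : ℕ} {a : Fin k → ℝ} (ha : Antitone a) : decr a = a := by
  have h : a ∘ Fin.revPerm = a ∘ Tuple.sort a :=
    Tuple.comp_sort_eq_comp_iff_monotone.2 fun _ _ h => ha (Fin.rev_le_rev.2 h)
  ext i
  have := congrFun h (Fin.rev i)
  simpa [decr] using this.symm

lemma tailSum_le_sum_of_antitone {k : ℕ} {c : Fin k → ℝ} (hc : Antitone c) (S : Finset (Fin k)) :
    tailSum c S.card ≤ ∑ s ∈ S, c s := by
  have hS : S.card ≤ k := by simpa using S.card_le_univ
  rcases S.eq_empty_or_nonempty with rfl | hne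
  · simp
  have hpos := hne.card_pos
  set v : Fin k := ⟨k - S.card, by omega⟩ with hv
  have hcard : (Finset.Ici v).card = S.card := by
    rw [Fin.card_Ici]
    simp only [hv]
    omega
  -- Both sets have the same size, so subtracting the threshold `c v` changes nothing in the
  -- comparison; it makes the terms in `Ici v` nonpositive and those outside nonnegative.
  have key : ∑ s ∈ Finset.Ici v, (c s - c v) ≤ ∑ s ∈ S, (c s - c v) := by
    calc ∑ s ∈ Finset.Ici v, (c s - c v) ≤ ∑ s ∈ Finset.Ici v ∩ S, (c s - c v) := by
          rw [← Finset.sum_inter_add_sum_sdiff (Finset.Ici v) S]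
          refine add_le_of_nonpos_right (Finset.sum_nonpos fun s hs => ?_)
          have := hc (Finset.mem_Ici.1 (Finset.mem_sdiff.1 hs).1)
          linarith
      _ ≤ ∑ s ∈ S, (c s - c v) := by
          refine Finset.sum_le_sum_of_subset_of_nonneg Finset.inter_subset_right ?_
          intro s hs hns
          have hsv : s ≤ v := by
            by_contra h
            exact hns (Finset.mem_inter.2 ⟨Finset.mem_Ici.2 (not_le.1 h).le, hs⟩)
          have := hc hsv
          linarith
  rw [Finset.sum_sub_distrib, Finset.sum_sub_distrib, Finset.sum_const, Finset.sum_const, hcard,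
    sum_Ici_eq_tailSum, hv] at key
  simp only [Nat.sub_sub_self hS] at key
  linarith

lemma tailSum_decr_le_sum {k : ℕ} (b : Fin k → ℝ) (S : Finset (Fin k)) :
    tailSum (decr b) S.card ≤ ∑ s ∈ S, b s := by
  have h := tailSum_le_sum_of_antitone (antitone_decr b) (S.map (decrPerm b).symm.toEmbedding)
  simpa [decr_eq_apply_decrPerm] using h

lemma exists_sum_eq_sum_Ici_decr {k : ℕ} (b : Fin k → ℝ) (t : Fin k) :
    ∃ S : Finset (Fin k), S.card = k - t ∧ ∑ s ∈ S, b s = ∑ s ∈ Finset.Ici t, decr b s :=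
  ⟨(Finset.Ici t).map (decrPerm b).toEmbedding, by simp, by simp [decr_eq_apply_decrPerm]⟩

/-- A tail sum of `decr b` is the least sum of `b` over sets of that size. This form removes the
rearrangement from all later arguments. -/
lemma weakMaj_iff {k : ℕ} {a b : Fin k → ℝ} (ha : Antitone a) :
    WeakMaj a b ↔ ∀ S : Finset (Fin k), tailSum a S.card ≤ ∑ s ∈ S, b s := by
  simp only [WeakMaj, decr_of_antitone ha]
  constructor
  · intro h S
    have hS : S.card ≤ k := by simpa using S.card_le_univ
    rcases S.eq_empty_or_nonempty with rfl | hne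
    · simp
    have hpos := hne.card_pos
    have := h ⟨k - S.card, by omega⟩
    rw [sum_Ici_eq_tailSum, sum_Ici_eq_tailSum] at this
    simp only [Nat.sub_sub_self hS] at this
    exact this.trans (tailSum_decr_le_sum b S)
  · intro h t
    obtain ⟨S, hS, hb⟩ := exists_sum_eq_sum_Ici_decr b t
    rw [← hb, sum_Ici_eq_tailSum, ← hS]
    exact h S

/-! ### The purchase policy -/

lemma antitone_lastEntries {T : ℕ} {d : Fin T → ℝ} (hd : Antitone d) (t : Fin T) :
    Antitone (lastEntries d t) := fun _ _ h =>
  hd (Fin.le_def.2 (Nat.add_le_add_left (Fin.le_def.1 h) _))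

lemma tailSum_lastEntries {T : ℕ} (d : Fin T → ℝ) (t : Fin T) {m : ℕ} (hm : m ≤ t + 1) :
    tailSum (lastEntries d t) m = tailSum d m := by
  refine Finset.sum_congr rfl fun i hi => ?_
  have := Finset.mem_range.1 hi
  have := t.isLt
  rw [dif_pos (by omega), dif_pos (by omega)]
  unfold lastEntries
  congr 2
  simp only
  omega

/-- Sets of at most `t + 1` slots see only the last `t + 1` entries of `d`, so the condition in slot
`t` is the part of the full family that concerns subsets of `Iic t`. -/
lemma weakMaj_partialSupply_iff {T : ℕ} {d : Fin T → ℝ} (hd : Antitone d) (p a : Fin T → ℝ)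
    (t : Fin T) (x : ℝ) :
    WeakMaj (lastEntries d t) (partialSupply p a t x) ↔
      ∀ S ⊆ Finset.Iic t, tailSum d S.card ≤ ∑ s ∈ S, if s < t then p s + a s else p t + x := by
  rw [weakMaj_iff (antitone_lastEntries hd t)]
  constructor
  · intro h S hS
    have hsub : S ⊆ Finset.univ.map (Fin.castLEEmb t.isLt) := by
      intro s hs
      have := Fin.le_def.1 (Finset.mem_Iic.1 (hS hs))
      exact Finset.mem_map.2 ⟨⟨s, by omega⟩, Finset.mem_univ _, rfl⟩
    obtain ⟨S', -, rfl⟩ := Finset.subset_map_iff.1 hsub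
    have hcard : S'.card ≤ t + 1 := by simpa using S'.card_le_univ
    have := h S'
    rw [tailSum_lastEntries d t hcard] at this
    rw [Finset.card_map, Finset.sum_map]
    exact this
  · intro h S
    have hcard : S.card ≤ t + 1 := by simpa using S.card_le_univ
    have := h (S.map (Fin.castLEEmb t.isLt)) (by
      intro s hs
      obtain ⟨i, -, rfl⟩ := Finset.mem_map.1 hs
      simp only [Finset.mem_Iic, Fin.le_def, Fin.coe_castLEEmb, Fin.val_castLE]
      omega)
    rw [Finset.card_map, Finset.sum_map] at this
    rw [tailSum_lastEntries d t hcard]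
    exact this

lemma leastPurchase_eq_sInf {T : ℕ} (d p : Fin T → ℝ) (t : Fin T) :
    leastPurchase d p t = sInf {x : ℝ | 0 ≤ x ∧
      WeakMaj (lastEntries d t) (partialSupply p (leastPurchase d p) t x)} := by
  rw [leastPurchase]
  congr 1
  ext x
  have : partialSupply p (fun s => if _h : s < t then leastPurchase d p s else 0) t x =
      partialSupply p (leastPurchase d p) t x := by
    ext s
    unfold partialSupply
    by_cases h : (s : ℕ) < t
    · have h' : Fin.castLE t.isLt s < t := h
      simp [h, h']
    · simp [h]
  rw [Set.mem_ofPred_eq, Set.mem_ofPred_eq, this]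

/-- The least purchase in slot `t` exists, and it is either zero or makes a tail constraint that
involves slot `t` tight. -/
lemma leastPurchase_spec {T : ℕ} {d : Fin T → ℝ} (hd : Antitone d) (p : Fin T → ℝ) (t : Fin T) :
    IsLeast {x : ℝ | 0 ≤ x ∧
        WeakMaj (lastEntries d t) (partialSupply p (leastPurchase d p) t x)}
      (leastPurchase d p t) ∧
    (∀ S ⊆ Finset.Iic t, tailSum d S.card ≤ ∑ s ∈ S, (p s + leastPurchase d p s)) ∧
    (leastPurchase d p t = 0 ∨ ∃ S ⊆ Finset.Iic t, t ∈ S ∧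
      tailSum d S.card = ∑ s ∈ S, (p s + leastPurchase d p s)) := by
  induction t using WellFoundedLT.induction with
  | ind t ih =>
  set a := leastPurchase d p with ha
  -- `f S` is the purchase in slot `t` that the inequality for `insert t S` demands; the least
  -- purchase is the positive part of the maximum of `f`, and a maximizer gives the tight set.
  set f : Finset (Fin T) → ℝ := fun S => tailSum d (S.card + 1) - ∑ s ∈ S, (p s + a s) - p t
    with hf
  have hne : (Finset.Iio t).powerset.Nonempty := ⟨∅, by simp⟩
  set m := (Finset.Iio t).powerset.sup' hne f with hm
  have hsum : ∀ S ⊆ Finset.Iio t, ∀ x, ∑ s ∈ insert t S, (if s < t then p s + a s else p t + x) =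
      p t + x + ∑ s ∈ S, (p s + a s) := by
    intro S hS x
    rw [Finset.sum_insert (fun h => lt_irrefl t (Finset.mem_Iio.1 (hS h)))]
    congr 1
    · simp
    · exact Finset.sum_congr rfl fun s hs => if_pos (Finset.mem_Iio.1 (hS hs))
  have hcard : ∀ S ⊆ Finset.Iio t, (insert t S).card = S.card + 1 := fun S hS =>
    Finset.card_insert_of_notMem fun h => lt_irrefl t (Finset.mem_Iio.1 (hS h))
  have hins : ∀ S ⊆ Finset.Iio t, insert t S ⊆ Finset.Iic t := fun S hS s hs => by
    rcases Finset.mem_insert.1 hs with rfl | h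
    · simp
    · exact Finset.mem_Iic.2 (Finset.mem_Iio.1 (hS h)).le
  have herase : ∀ S ⊆ Finset.Iic t, S.erase t ⊆ Finset.Iio t := fun S hS s hs =>
    Finset.mem_Iio.2 (lt_of_le_of_ne (Finset.mem_Iic.1 (hS (Finset.mem_of_mem_erase hs)))
      (Finset.ne_of_mem_erase hs))
  have hleast : IsLeast {x : ℝ | 0 ≤ x ∧
      WeakMaj (lastEntries d t) (partialSupply p a t x)} (max m 0) := by
    refine ⟨⟨le_max_right _ _, ?_⟩, ?_⟩
    · rw [weakMaj_partialSupply_iff hd]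
      intro S hS
      by_cases ht : t ∈ S
      · have h' := herase S hS
        rw [← Finset.insert_erase ht, hsum _ h', hcard _ h']
        have h1 : f (S.erase t) ≤ m := Finset.le_sup' f (Finset.mem_powerset.2 h')
        have h2 : m ≤ max m 0 := le_max_left _ _
        simp only [hf] at h1
        linarith
      · have hlt : ∀ s ∈ S, s < t := fun s hs =>
          lt_of_le_of_ne (Finset.mem_Iic.1 (hS hs)) fun h => ht (h ▸ hs)
        rw [Finset.sum_congr rfl fun s hs => if_pos (hlt s hs)]
        -- A set that avoids `t` puts no condition on the purchase: its inequality was already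
        -- secured in the slot of its largest element.
        rcases S.eq_empty_or_nonempty with rfl | hSne
        · simp
        · exact (ih _ (hlt _ (S.max'_mem hSne))).2.1 S fun s hs =>
            Finset.mem_Iic.2 (S.le_max' s hs)
    · rintro x ⟨hx0, hx⟩
      rw [weakMaj_partialSupply_iff hd] at hx
      refine max_le (Finset.sup'_le _ _ fun S hS => ?_) hx0
      have hS := Finset.mem_powerset.1 hS
      have := hx _ (hins S hS)
      rw [hcard S hS, hsum S hS] at this
      simp only [hf]
      linarith
  have hat : a t = max m 0 := by
    rw [ha, leastPurchase_eq_sInf, ← ha]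
    exact hleast.csInf_eq
  rw [← hat] at hleast
  refine ⟨hleast, fun S hS => ?_, ?_⟩
  · refine ((weakMaj_partialSupply_iff hd _ _ _ _).1 hleast.1.2 S hS).trans_eq
      (Finset.sum_congr rfl fun s hs => ?_)
    split_ifs with h
    · rfl
    · rw [le_antisymm (Finset.mem_Iic.1 (hS hs)) (not_lt.1 h)]
  · rcases le_total m 0 with h0 | h0
    · exact Or.inl (hat.trans (max_eq_right h0))
    · right
      obtain ⟨S, hS, hSm⟩ := Finset.exists_mem_eq_sup' hne f
      have hS := Finset.mem_powerset.1 hS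
      refine ⟨insert t S, hins S hS, Finset.mem_insert_self _ _, ?_⟩
      rw [hcard S hS, Finset.sum_insert (fun h => lt_irrefl t (Finset.mem_Iio.1 (hS h))), hat,
        max_eq_left h0, hm, hSm]
      simp only [hf]
      ring

lemma leastPurchase_nonneg {T : ℕ} {d : Fin T → ℝ} (hd : Antitone d) (p : Fin T → ℝ)
    (t : Fin T) : 0 ≤ leastPurchase d p t :=
  (leastPurchase_spec hd p t).1.1.1

lemma tailSum_card_le_sum_leastPurchase {T : ℕ} {d : Fin T → ℝ} (hd : Antitone d)
    (p : Fin T → ℝ) (S : Finset (Fin T)) :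
    tailSum d S.card ≤ ∑ s ∈ S, (p s + leastPurchase d p s) := by
  rcases S.eq_empty_or_nonempty with rfl | hS
  · simp
  · exact (leastPurchase_spec hd p (S.max' hS)).2.1 S fun s hs => Finset.mem_Iic.2 (S.le_max' s hs)

lemma leastPurchase_congr {T : ℕ} (d : Fin T → ℝ) {p p' : Fin T → ℝ} (t : Fin T)
    (h : ∀ s ≤ t, p s = p' s) : leastPurchase d p t = leastPurchase d p' t := by
  induction t using WellFoundedLT.induction with
  | ind t ih =>
  rw [leastPurchase_eq_sInf, leastPurchase_eq_sInf]
  have : ∀ x, partialSupply p (leastPurchase d p) t x =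
      partialSupply p' (leastPurchase d p') t x := by
    intro x
    ext s
    unfold partialSupply
    split_ifs with hs
    · have hs' : Fin.castLE t.isLt s < t := hs
      rw [ih _ hs' fun r hr => h r (hr.trans hs'.le), h _ hs'.le]
    · rw [h t le_rfl]
  simp only [this]

lemma leastPurchase_of_val_eq_zero {T : ℕ} {d : Fin T → ℝ} (hd : Antitone d) (p : Fin T → ℝ)
    (t : Fin T) (ht : (t : ℕ) = 0) : leastPurchase d p t = max (d (Fin.rev t) - p t) 0 := by
  have hone : tailSum d 1 = d (Fin.rev t) := by
    have := t.isLt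
    simp only [tailSum, Finset.sum_range_one]
    rw [dif_pos (by omega)]
    congr 1
    ext
    simp only [Fin.val_rev]
    omega
  have h0 := leastPurchase_nonneg hd p t
  have h1 := tailSum_card_le_sum_leastPurchase hd p {t}
  simp only [Finset.card_singleton, Finset.sum_singleton, hone] at h1
  rcases (leastPurchase_spec hd p t).2.2 with h | ⟨S, hS, htS, hSt⟩
  · rw [h] at h1 ⊢
    rw [max_eq_right (by linarith)]
  · have : S = {t} := by
      refine Finset.eq_singleton_iff_unique_mem.2 ⟨htS, fun s hs => Fin.ext ?_⟩
      have := Fin.le_def.1 (Finset.mem_Iic.1 (hS hs))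
      omega
    subst this
    simp only [Finset.card_singleton, Finset.sum_singleton, hone] at hSt
    rw [max_eq_left (by linarith)]
    linarith

lemma exists_int_tailSum {T : ℕ} {d : Fin T → ℝ} (hd : ∀ t, ∃ z : ℤ, d t = z) (m : ℕ) :
    ∃ z : ℤ, tailSum d m = z := by
  choose z hz using hd
  refine ⟨∑ i ∈ Finset.range m, if h : i < T then z ⟨T - 1 - i, by omega⟩ else 0, ?_⟩
  unfold tailSum
  push_cast
  refine Finset.sum_congr rfl fun i _ => ?_
  split_ifs <;> simp [hz]

/-- A nonzero purchase solves a tight equation whose other terms are integers. -/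
lemma exists_nat_leastPurchase {T : ℕ} {d p : Fin T → ℝ} (hd : Antitone d)
    (hdz : ∀ t, ∃ z : ℤ, d t = z) (hpz : ∀ t, ∃ z : ℤ, p t = z) (t : Fin T) :
    ∃ k : ℕ, leastPurchase d p t = k := by
  choose z hz using hpz
  induction t using WellFoundedLT.induction with
  | ind t ih =>
  rcases (leastPurchase_spec hd p t).2.2 with h | ⟨S, hS, htS, hSt⟩
  · exact ⟨0, by simpa using h⟩
  · have hlt : ∀ s ∈ S.erase t, s < t := fun s hs =>
      lt_of_le_of_ne (Finset.mem_Iic.1 (hS (Finset.mem_of_mem_erase hs)))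
        (Finset.ne_of_mem_erase hs)
    have hex : ∀ s, ∃ k : ℕ, s < t → leastPurchase d p s = k := fun s => by
      by_cases hs : s < t
      · obtain ⟨k, hk⟩ := ih s hs
        exact ⟨k, fun _ => hk⟩
      · exact ⟨0, fun h => absurd h hs⟩
    choose k hk using hex
    obtain ⟨D, hD⟩ := exists_int_tailSum hdz S.card
    rw [← Finset.add_sum_erase _ _ htS, hD,
      Finset.sum_congr rfl fun s hs => by rw [hz s, hk s (hlt s hs)], hz t] at hSt
    have heq : leastPurchase d p t =
        ((D - z t - ∑ s ∈ S.erase t, (z s + k s) : ℤ) : ℝ) := by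
      push_cast
      linarith
    have hnn := leastPurchase_nonneg hd p t
    rw [heq] at hnn ⊢
    obtain ⟨l, hl⟩ := Int.eq_ofNat_of_zero_le (Int.cast_nonneg_iff.1 hnn)
    exact ⟨l, by rw [hl]; simp⟩

/-! ### Tight sets and the total purchase -/

/-- Uncrossing: supermodularity bounds the sum of the two tight values by the values at the union
and the intersection, and the inequality at the intersection leaves no slack at the union. -/
lemma tailSum_union_eq_sum {T : ℕ} {d q : Fin T → ℝ} (hd : Antitone d)
    (h : ∀ S : Finset (Fin T), tailSum d S.card ≤ ∑ s ∈ S, q s) {A B : Finset (Fin T)}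
    (hA : tailSum d A.card = ∑ s ∈ A, q s) (hB : tailSum d B.card = ∑ s ∈ B, q s) :
    tailSum d (A ∪ B).card = ∑ s ∈ A ∪ B, q s := by
  refine le_antisymm (h _) ?_
  have h1 := Finset.sum_union_inter (s₁ := A) (s₂ := B) (f := q)
  have h2 := Finset.card_union_add_card_inter A B
  have h3 := Finset.card_le_card (Finset.inter_subset_right (s₁ := A) (s₂ := B))
  have h4 := Finset.card_le_card (Finset.inter_subset_left (s₁ := A) (s₂ := B))
  have h5 : (A ∪ B).card ≤ T := by simpa using (A ∪ B).card_le_univ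
  have h6 := tailSum_supermodular hd (m := (A ∩ B).card) (n := B.card)
    (a := A.card - (A ∩ B).card) h3 (by omega)
  have e1 : (A ∩ B).card + (A.card - (A ∩ B).card) = A.card := by omega
  have e2 : B.card + (A.card - (A ∩ B).card) = (A ∪ B).card := by omega
  rw [e1, e2] at h6
  have h7 := h (A ∩ B)
  linarith

/-- Some tight tail constraint involves every slot with a purchase. -/
lemma exists_sum_leastPurchase_eq {T : ℕ} {d : Fin T → ℝ} (hd : Antitone d) (p : Fin T → ℝ) :
    ∃ S : Finset (Fin T), ∑ t, leastPurchase d p t = tailSum d S.card - ∑ s ∈ S, p s := by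
  have key : ∀ A : Finset (Fin T), ∃ S : Finset (Fin T),
      tailSum d S.card = ∑ s ∈ S, (p s + leastPurchase d p s) ∧
      ∀ t ∈ A, t ∉ S → leastPurchase d p t = 0 := by
    intro A
    induction A using Finset.induction_on with
    | empty => exact ⟨∅, by simp, by simp⟩
    | insert t A _ ih =>
      obtain ⟨S, hS, hA⟩ := ih
      rcases (leastPurchase_spec hd p t).2.2 with h | ⟨S', -, htS, hSt⟩
      · refine ⟨S, hS, fun s hs hsS => ?_⟩
        rcases Finset.mem_insert.1 hs with rfl | hs
        · exact h
        · exact hA s hs hsS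
      · refine ⟨S ∪ S', tailSum_union_eq_sum hd (tailSum_card_le_sum_leastPurchase hd p) hS hSt,
          fun s hs hsS => ?_⟩
        rw [Finset.notMem_union] at hsS
        rcases Finset.mem_insert.1 hs with rfl | hs
        · exact absurd htS hsS.2
        · exact hA s hs hsS.1
  obtain ⟨S, hS, h0⟩ := key Finset.univ
  refine ⟨S, ?_⟩
  rw [hS, Finset.sum_add_distrib, add_sub_cancel_left]
  exact (Finset.sum_subset (Finset.subset_univ S) fun t _ ht => h0 t (Finset.mem_univ t) ht).symm

/-! ### Least-laxity-first serves everything -/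

/-- Replacing the served part of a population: if the `q` members of smallest laxity are served,
and the laxity of the others decreases by one, the total shortfall at level `m` after the slot is
bounded by the supply. -/
lemma sum_posPart_le_of_ranking {J : Type} [Fintype J] (π : J ≃ Fin (Fintype.card J)) (l : J → ℤ)
    (hmono : ∀ j k, π j < π k → l j ≤ l k) (q : ℕ) (m b : ℤ)
    (hm : ∑ j, max (m - l j) 0 ≤ b) (hm1 : ∑ j, max (m + 1 - l j) 0 ≤ q + b) :
    ∑ j, (if (π j : ℕ) + 1 ≤ q then max (m - l j) 0 else max (m + 1 - l j) 0) ≤ b := by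
  -- If an unserved member has laxity at most `m`, then exactly `q` members are served, all of
  -- laxity at most `m`, and each lowers its term in `hm1` by one. Otherwise unserved members
  -- contribute zero and `hm` suffices.
  by_cases h : ∃ k, ¬ ((π k : ℕ) + 1 ≤ q) ∧ l k ≤ m
  · obtain ⟨k, hk, hlk⟩ := h
    have hcard : (Finset.univ.filter fun j : J => (π j : ℕ) + 1 ≤ q).card = q := by
      have hq : q ≤ Fintype.card J := by
        have := (π k).isLt
        omega
      rw [← Finset.card_map π.toEmbedding]
      have : (Finset.univ.filter fun j : J => (π j : ℕ) + 1 ≤ q).map π.toEmbedding =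
          Finset.univ.filter fun i : Fin (Fintype.card J) => (i : ℕ) < q := by
        ext i
        simp only [Finset.mem_map_equiv, Finset.mem_filter, Finset.mem_univ, true_and,
          Equiv.apply_symm_apply]
        omega
      rw [this, Fin.card_filter_val_lt, min_eq_right hq]
    have hsum : ∑ j, (if (π j : ℕ) + 1 ≤ q then max (m - l j) 0 else max (m + 1 - l j) 0) =
        ∑ j, (max (m + 1 - l j) 0 - if (π j : ℕ) + 1 ≤ q then 1 else 0) := by
      refine Finset.sum_congr rfl fun j _ => ?_
      split_ifs with hj
      · have : l j ≤ l k := hmono j k (Fin.lt_def.2 (by omega))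
        omega
      · simp
    rw [hsum, Finset.sum_sub_distrib, Finset.sum_boole, hcard]
    linarith
  · push Not at h
    refine le_trans (Finset.sum_le_sum fun j _ => ?_) hm
    split_ifs with hj
    · exact le_rfl
    · have := h j (by omega)
      omega

/-- A least-laxity-first allocation serves everything, if every set of slots has enough supply for
the energy that cannot be delivered outside it. -/
lemma IsLLF.sum_eq {J : Type} [Fintype J] {T : ℕ} {E : J → ℕ} {q : Fin T → ℕ}
    {ν : J → Fin T → ℕ} (hν : IsLLF E (fun t => (q t : ℝ)) ν)
    (hq : ∀ S : Finset (Fin T), ∑ j, max ((S.card : ℤ) - (T - E j)) 0 ≤ ∑ s ∈ S, (q s : ℤ))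
    (j : J) : ∑ t, ν j t = E j := by
  set X : ℕ → J → ℤ := fun t j => (E j : ℤ) - ∑ s with (s : Fin T) < t, (ν j s : ℤ) with hX
  have hrem : ∀ (t : Fin T) j, remaining E ν t j = X t j := by
    intro t j
    simp only [remaining, hX]
    congr 2
    ext s
    simp
  have hstep : ∀ (t : Fin T) j, X (t + 1) j = X t j - ν j t := by
    intro t j
    simp only [hX]
    have : (Finset.univ.filter fun s : Fin T => (s : ℕ) < t + 1) =
        insert t (Finset.univ.filter fun s : Fin T => (s : ℕ) < t) := by
      ext s
      simp [Fin.ext_iff]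
      omega
    rw [this, Finset.sum_insert (by simp)]
    ring
  -- The invariant: the hypothesis `hq`, with the current laxities `T - t - X t j` and restricted to
  -- sets of remaining slots. The induction step uses it for `S` and for `S` with the current slot
  -- added.
  have key : ∀ t ≤ T, (∀ j, 0 ≤ X t j) ∧ ∀ S : Finset (Fin T), (∀ s ∈ S, t ≤ (s : ℕ)) →
      ∑ j, max ((S.card : ℤ) - (T - t - X t j)) 0 ≤ ∑ s ∈ S, (q s : ℤ) := by
    intro t
    induction t with
    | zero =>
      intro _
      refine ⟨fun j => by simp [hX], fun S _ => ?_⟩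
      simpa [hX] using hq S
    | succ t ih =>
      intro ht
      obtain ⟨hpos, hle⟩ := ih (by omega)
      obtain ⟨π, hπ, h1, h0⟩ := hν ⟨t, by omega⟩
      have hst := hstep ⟨t, by omega⟩
      simp only [hrem, laxity] at hπ h1 h0 hst
      have hcast : ∀ j, ((π j : ℕ) + 1 : ℝ) ≤ (q ⟨t, by omega⟩ : ℝ) ↔
          (π j : ℕ) + 1 ≤ q ⟨t, by omega⟩ := fun j => by exact_mod_cast Iff.rfl
      simp only [hcast] at h1 h0
      refine ⟨fun j => ?_, fun S hS => ?_⟩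
      · rw [hst]
        by_cases hj : (π j : ℕ) + 1 ≤ q ⟨t, by omega⟩ ∧ 0 < X t j
        · rw [h1 j hj]
          have := hj.2
          push_cast
          omega
        · rw [h0 j hj]
          simpa using hpos j
      · have htS : (⟨t, by omega⟩ : Fin T) ∉ S := fun h => by
          have := hS _ h
          simp at this
        have hA := hle S fun s hs => by have := hS s hs; omega
        have hB := hle (insert ⟨t, by omega⟩ S) fun s hs => by
          rcases Finset.mem_insert.1 hs with rfl | hs
          · exact le_rfl
          · have := hS s hs
            omega
        rw [Finset.card_insert_of_notMem htS, Finset.sum_insert htS] at hB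
        push_cast at hB
        -- Needed for a finished service of high rank: it gets nothing, so its laxity `T - t` drops
        -- by one, but its term is still zero.
        have hcardS : (S.card : ℤ) + 1 ≤ T - t := by
          have : S ⊆ Finset.Ioi ⟨t, by omega⟩ := fun s hs =>
            Finset.mem_Ioi.2 (Fin.lt_def.2 (hS s hs))
          have := Finset.card_le_card this
          rw [Fin.card_Ioi] at this
          simp only at this
          omega
        refine le_trans (Finset.sum_le_sum fun j _ => ?_)
          (sum_posPart_le_of_ranking π _ hπ (q ⟨t, by omega⟩) S.card _ hA hB)
        rw [hst]
        have := hpos j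
        push_cast
        by_cases hj : (π j : ℕ) + 1 ≤ q ⟨t, by omega⟩
        · rw [if_pos hj]
          rcases (hpos j).eq_or_lt with hx | hx
          · rw [h0 j (fun h => by omega)]
            push_cast
            omega
          · rw [h1 j ⟨hj, hx⟩]
            push_cast
            omega
        · rw [if_neg hj, h0 j (fun h => hj h.1)]
          push_cast
          omega
  obtain ⟨hpos, hle⟩ := key T le_rfl
  -- After the last slot, the empty set's inequality bounds the total unmet energy by zero.
  have h := hle ∅ (by simp)
  simp only [Finset.card_empty, Finset.sum_empty] at h
  have hz : max ((0 : ℕ) - ((T : ℤ) - T - X T j)) 0 ≤ 0 := le_trans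
    (Finset.single_le_sum (f := fun j => max (((0 : ℕ) : ℤ) - ((T : ℤ) - T - X T j)) 0)
      (fun _ _ => le_max_right _ _) (Finset.mem_univ j)) h
  have hzero : X T j = 0 := by
    have := hpos j
    omega
  simp only [hX, Fin.is_lt, Finset.filter_true] at hzero
  have : (∑ t, (ν j t : ℤ)) = E j := by linarith
  exact_mod_cast this

lemma IsLLF.le_one {J : Type} [Fintype J] {T : ℕ} {E : J → ℕ} {q : Fin T → ℝ}
    {ν : J → Fin T → ℕ} (hν : IsLLF E q ν) (j : J) (t : Fin T) : ν j t ≤ 1 := by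
  obtain ⟨π, -, h1, h0⟩ := hν t
  by_cases h : ((π j : ℕ) + 1 : ℝ) ≤ q t ∧ 0 < remaining E ν t j
  · exact (h1 j h).le
  · simp [h0 j h]

lemma IsLLF.sum_le {J : Type} [Fintype J] {T : ℕ} {E : J → ℕ} {q : Fin T → ℕ}
    {ν : J → Fin T → ℕ} (hν : IsLLF E (fun t => (q t : ℝ)) ν) (t : Fin T) :
    ∑ j, ν j t ≤ q t := by
  obtain ⟨π, -, h1, h0⟩ := hν t
  calc ∑ j, ν j t ≤ ∑ j, if (π j : ℕ) < q t then 1 else 0 := by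
        refine Finset.sum_le_sum fun j _ => ?_
        by_cases h : ((π j : ℕ) + 1 : ℝ) ≤ q t ∧ 0 < remaining E ν t j
        · rw [h1 j h, if_pos (by exact_mod_cast h.1)]
        · rw [h0 j h]
          exact Nat.zero_le _
    _ = ∑ i : Fin (Fintype.card J), if (i : ℕ) < q t then 1 else 0 :=
        Equiv.sum_comp π fun i => if (i : ℕ) < q t then 1 else 0
    _ ≤ q t := by
        rw [Finset.sum_boole, Fin.card_filter_val_lt]
        exact min_le_right _ _

/-! ### A causal least-laxity-first allocation -/

lemma exists_ranking {J : Type} [Fintype J] (l : J → ℤ) :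
    ∃ π : J ≃ Fin (Fintype.card J), ∀ j k, π j < π k → l j ≤ l k := by
  let e := Fintype.equivFin J
  refine ⟨e.trans (Tuple.sort (l ∘ e.symm)).symm, fun j k h => ?_⟩
  have := Tuple.monotone_sort (l ∘ e.symm) h.le
  simpa using this

/-- A ranking of the services by increasing laxity. -/
noncomputable def ranking {J : Type} [Fintype J] (l : J → ℤ) : J ≃ Fin (Fintype.card J) :=
  (exists_ranking l).choose

open Classical in
/-- Energy delivered in slot `t`, with supply `q`, when the energies `x` are still needed. -/
noncomputable def llfServe {J : Type} [Fintype J] (T t : ℕ) (q : ℝ) (x : J → ℤ) (j : J) : ℕ :=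
  if ((ranking (fun j => ((T : ℤ) - t) - x j) j : ℕ) + 1 : ℝ) ≤ q ∧ 0 < x j then 1 else 0

/-- Energies needed at the beginning of slot `t` under a least-laxity-first allocation. -/
noncomputable def llfState {J : Type} [Fintype J] {T : ℕ} (E : J → ℕ) (q : Fin T → ℝ) :
    ℕ → J → ℤ
  | 0 => fun j => E j
  | t + 1 => fun j => llfState E q t j -
      if h : t < T then (llfServe T t (q ⟨t, h⟩) (llfState E q t) j : ℤ) else 0

/-- A least-laxity-first allocation. -/
noncomputable def llf {J : Type} [Fintype J] {T : ℕ} (E : J → ℕ) (q : Fin T → ℝ) (j : J)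
    (t : Fin T) : ℕ :=
  llfServe T t (q t) (llfState E q t) j

/-- The recursive state avoids a circular definition of the allocation through its own history; here
the two descriptions are matched. -/
lemma remaining_llf {J : Type} [Fintype J] {T : ℕ} (E : J → ℕ) (q : Fin T → ℝ) (t : Fin T)
    (j : J) : remaining E (llf E q) t j = llfState E q t j := by
  have key : ∀ t ≤ T, (E j : ℤ) - ∑ s with (s : Fin T) < t, (llf E q j s : ℤ) =
      llfState E q t j := by
    intro t
    induction t with
    | zero => simp [llfState]
    | succ t ih =>
      intro ht
      have : (Finset.univ.filter fun s : Fin T => (s : ℕ) < t + 1) =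
          insert ⟨t, by omega⟩ (Finset.univ.filter fun s : Fin T => (s : ℕ) < t) := by
        ext s
        simp [Fin.ext_iff]
        omega
      rw [this, Finset.sum_insert (by simp), ← sub_sub, sub_right_comm, ih (by omega)]
      simp only [llfState, llf]
      rw [dif_pos (by omega)]
  rw [← key t t.isLt.le, remaining]
  congr 2
  ext s
  simp

lemma isLLF_llf {J : Type} [Fintype J] {T : ℕ} (E : J → ℕ) (q : Fin T → ℝ) :
    IsLLF E q (llf E q) := by
  intro t
  refine ⟨ranking fun j => ((T : ℤ) - (t : ℕ)) - llfState E q t j, fun j k h => ?_,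
    fun j h => ?_, fun j h => ?_⟩
  · simp only [laxity, remaining_llf]
    exact (exists_ranking fun j => ((T : ℤ) - (t : ℕ)) - llfState E q t j).choose_spec j k h
  · rw [remaining_llf] at h
    exact if_pos h
  · rw [remaining_llf] at h
    exact if_neg h

lemma llf_congr {J : Type} [Fintype J] {T : ℕ} (E : J → ℕ) {q q' : Fin T → ℝ} (t : Fin T)
    (h : ∀ s ≤ t, q s = q' s) (j : J) : llf E q j t = llf E q' j t := by
  have key : ∀ m ≤ (t : ℕ), llfState E q m = llfState E q' m := by
    intro m
    induction m with
    | zero => intro _; rfl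
    | succ m ih =>
      intro hm
      ext j
      have := t.isLt
      simp only [llfState]
      rw [dif_pos (by omega), dif_pos (by omega), ih (by omega),
        h ⟨m, by omega⟩ (Fin.le_def.2 (by simp only; omega))]
  rw [llf, llf, key t le_rfl, h t le_rfl]

/-! ### The demand vector and the unit-rate decomposition -/

lemma antitone_demand {n : ℕ} (C : Fin n → Service) (T : ℕ) : Antitone (demand C T) := by
  intro s t hst
  refine Nat.cast_le.2 (Finset.card_le_card fun j hj => ?_)
  simp only [Finset.mem_filter, Finset.mem_univ, true_and] at hj ⊢
  have := Fin.le_def.1 hst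
  omega

lemma unitEnergy_le {n T : ℕ} {C : Fin n → Service} (hC : ∀ i, (C i).energy ≤ (C i).rate * T)
    (j : UnitIndex C) : unitEnergy C j ≤ T := by
  have h := hC j.1
  unfold unitEnergy
  split_ifs with hj
  · by_contra hlt
    have h1 : T ≤ (C j.1).energy / (C j.1).rate := by omega
    have h2 := Nat.mul_le_mul_left (C j.1).rate h1
    have h3 := Nat.div_add_mod (C j.1).energy (C j.1).rate
    omega
  · exact Nat.div_le_of_le_mul h

/-- Double counting: raising `m` by one adds one for each unit service with energy at least `T - m`,
and there are `demand` many of these in the slot added. -/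
lemma tailSum_demand {n T : ℕ} {C : Fin n → Service}
    (hC : ∀ i, (C i).energy ≤ (C i).rate * T) {m : ℕ} (hm : m ≤ T) :
    tailSum (demand C T) m =
      ((∑ j, max ((m : ℤ) - (T - unitEnergy C j)) 0 : ℤ) : ℝ) := by
  induction m with
  | zero =>
    rw [tailSum_zero, Finset.sum_eq_zero]
    · simp
    · intro j _
      have := unitEnergy_le hC j
      push_cast
      omega
  | succ m ih =>
    have hsucc : tailSum (demand C T) (m + 1) =
        tailSum (demand C T) m + demand C T ⟨T - 1 - m, by omega⟩ := by
      simp only [tailSum, Finset.sum_range_succ]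
      rw [dif_pos (by omega)]
    have hstep : ∑ j, max (((m + 1 : ℕ) : ℤ) - (T - unitEnergy C j)) 0 =
        ∑ j, (max ((m : ℤ) - (T - unitEnergy C j)) 0 +
          if T - 1 - m + 1 ≤ unitEnergy C j then 1 else 0) := by
      refine Finset.sum_congr rfl fun j _ => ?_
      have := unitEnergy_le hC j
      push_cast
      split_ifs <;> omega
    rw [hsucc, ih (by omega), hstep, Finset.sum_add_distrib, Finset.sum_boole, demand]
    push_cast
    rfl

lemma sum_unitEnergy {n : ℕ} (C : Fin n → Service) {i : Fin n} (hi : 0 < (C i).rate) :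
    ∑ j : Fin (C i).rate, unitEnergy C ⟨i, j⟩ = (C i).energy := by
  have h : ∀ j : Fin (C i).rate, unitEnergy C ⟨i, j⟩ = (C i).energy / (C i).rate +
      if (j : ℕ) < (C i).energy % (C i).rate then 1 else 0 := by
    intro j
    unfold unitEnergy
    split_ifs <;> rfl
  simp only [h]
  rw [Finset.sum_add_distrib, Finset.sum_boole, Fin.card_filter_val_lt,
    min_eq_right (Nat.mod_lt _ hi).le]
  simpa using Nat.div_add_mod (C i).energy (C i).rate

/-- The parts have only the two consecutive energies `k` and `k + 1`, so no integer `c` lies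
strictly between them, and positive parts can be taken after summing. This is why the decomposition
must be balanced. -/
lemma sum_posPart_unitEnergy_le {n : ℕ} (C : Fin n → Service) (i : Fin n) (c : ℕ) :
    ∑ j : Fin (C i).rate, max ((unitEnergy C ⟨i, j⟩ : ℤ) - c) 0 ≤
      max (((C i).energy : ℤ) - (C i).rate * c) 0 := by
  rcases Nat.eq_zero_or_pos (C i).rate with h0 | hpos
  · have : IsEmpty (Fin (C i).rate) := by
      rw [h0]
      infer_instance
    rw [Finset.univ_eq_empty, Finset.sum_empty]
    exact le_max_right _ _
  by_cases hc : c ≤ (C i).energy / (C i).rate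
  · refine le_trans (le_of_eq ?_) (le_max_left _ _)
    have h : ∀ j : Fin (C i).rate, max ((unitEnergy C ⟨i, j⟩ : ℤ) - c) 0 =
        (unitEnergy C ⟨i, j⟩ : ℤ) - c := by
      intro j
      refine max_eq_left ?_
      unfold unitEnergy
      split_ifs <;> simp only <;> omega
    simp only [h]
    rw [Finset.sum_sub_distrib, ← Nat.cast_sum, sum_unitEnergy C hpos]
    simp
  · refine le_trans (le_of_eq (Finset.sum_eq_zero fun j _ => ?_)) (le_max_right _ _)
    refine max_eq_right ?_
    unfold unitEnergy
    split_ifs <;> simp only <;> omega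

/-- Outside `S` a service receives at most its rate times `T - S.card`, so the rest of its energy
must be delivered in `S`. -/
lemma Meets.tailSum_le {n T : ℕ} {C : Fin n → Service} {q : Fin T → ℝ} {u : Fin n → Fin T → ℕ}
    (hu : Meets C q u) (hC : ∀ i, (C i).energy ≤ (C i).rate * T) (S : Finset (Fin T)) :
    tailSum (demand C T) S.card ≤ ∑ s ∈ S, q s := by
  have hcard : S.card ≤ T := by simpa using S.card_le_univ
  have hi : ∀ i, ∑ j : Fin (C i).rate, max ((S.card : ℤ) - (T - unitEnergy C ⟨i, j⟩)) 0 ≤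
      ∑ s ∈ S, (u i s : ℤ) := by
    intro i
    have h1 := sum_posPart_unitEnergy_le C i (T - S.card)
    have h2 : ∑ j : Fin (C i).rate, max ((S.card : ℤ) - (T - unitEnergy C ⟨i, j⟩)) 0 =
        ∑ j : Fin (C i).rate, max ((unitEnergy C ⟨i, j⟩ : ℤ) - (T - S.card : ℕ)) 0 := by
      refine Finset.sum_congr rfl fun j _ => ?_
      congr 1
      omega
    rw [h2]
    refine h1.trans (max_le ?_ (Finset.sum_nonneg fun s _ => by positivity))
    have h3 : ∑ s ∈ S, u i s + ∑ s ∈ Sᶜ, u i s = (C i).energy := by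
      rw [Finset.sum_add_sum_compl, hu.energy_eq]
    have h4 : ∑ s ∈ Sᶜ, u i s ≤ (T - S.card) * (C i).rate := by
      have := Finset.sum_le_card_nsmul Sᶜ (u i) _ fun s _ => hu.rate_le i s
      simpa [Finset.card_compl] using this
    rw [mul_comm] at h4
    zify at h3 h4
    linarith
  calc tailSum (demand C T) S.card
      = ((∑ j, max ((S.card : ℤ) - (T - unitEnergy C j)) 0 : ℤ) : ℝ) := tailSum_demand hC hcard
    _ ≤ ((∑ i, ∑ s ∈ S, (u i s : ℤ) : ℤ) : ℝ) := by
        refine Int.cast_le.2 ?_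
        rw [Fintype.sum_sigma]
        exact Finset.sum_le_sum fun i _ => hi i
    _ = ∑ s ∈ S, ((∑ i, u i s : ℕ) : ℝ) := by
        rw [Finset.sum_comm]
        push_cast
        rfl
    _ ≤ ∑ s ∈ S, q s := Finset.sum_le_sum fun s _ => hu.supply_le s

lemma IsLLF.meets_bundle {n T : ℕ} {C : Fin n → Service}
    (hC : ∀ i, (C i).energy ≤ (C i).rate * T) {q : Fin T → ℕ} {ν : UnitIndex C → Fin T → ℕ}
    (hν : IsLLF (unitEnergy C) (fun t => (q t : ℝ)) ν)
    (hq : ∀ S : Finset (Fin T), tailSum (demand C T) S.card ≤ ∑ s ∈ S, (q s : ℝ)) :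
    Meets C (fun t => (q t : ℝ)) (bundle ν) := by
  have hsum := hν.sum_eq fun S => by
    have h := hq S
    rw [tailSum_demand hC (by simpa using S.card_le_univ)] at h
    exact_mod_cast h
  refine ⟨fun i => ?_, fun i t => ?_, fun t => Nat.cast_le.2 ?_⟩
  · simp only [bundle]
    rw [Finset.sum_comm]
    simp only [hsum]
    -- A service of rate zero has no parts, but `hC` forces its energy to be zero.
    rcases Nat.eq_zero_or_pos (C i).rate with h0 | hpos
    · have h := hC i
      have : IsEmpty (Fin (C i).rate) := by
        rw [h0]
        infer_instance
      rw [Finset.univ_eq_empty, Finset.sum_empty]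
      rw [h0] at h
      omega
    · exact sum_unitEnergy C hpos
  · calc bundle ν i t ≤ ∑ _j : Fin (C i).rate, 1 :=
          Finset.sum_le_sum fun j _ => hν.le_one ⟨i, j⟩ t
      _ = (C i).rate := by simp
  · refine le_trans (le_of_eq ?_) (hν.sum_le t)
    simp only [bundle]
    rw [Fintype.sum_sigma]

/-! ### The gap, optimality and the optimal cost -/

/-- With `gap_le`, this identifies `gap` as the largest deficit over all sets of slots; the empty
set accounts for the positive part. -/
lemma tailSum_sub_sum_le_gap {n T : ℕ} (C : Fin n → Service) (y r : Fin T → ℕ)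
    (S : Finset (Fin T)) :
    tailSum (demand C T) S.card - ∑ s ∈ S, baseSupply y r s ≤ gap C y r := by
  have hS : S.card ≤ T := by simpa using S.card_le_univ
  rcases S.eq_empty_or_nonempty with rfl | hne
  · simp [gap]
  have hpos := hne.card_pos
  have h1 := tailSum_decr_le_sum (baseSupply y r) S
  have h2 := le_ciSup (f := fun t : Fin T =>
    ∑ s ∈ Finset.Ici t, (demand C T s - decr (baseSupply y r) s)) (Set.finite_range _).bddAbove
    ⟨T - S.card, by omega⟩
  simp only [Finset.sum_sub_distrib, sum_Ici_eq_tailSum, Nat.sub_sub_self hS] at h2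
  refine le_trans ?_ (le_max_left _ _)
  simp only [Finset.sum_sub_distrib, sum_Ici_eq_tailSum]
  linarith

lemma gap_le {n T : ℕ} {C : Fin n → Service} {y r : Fin T → ℕ} {x : ℝ} (hT : 1 ≤ T)
    (h : ∀ S : Finset (Fin T),
      tailSum (demand C T) S.card - ∑ s ∈ S, baseSupply y r s ≤ x) : gap C y r ≤ x := by
  have : Nonempty (Fin T) := ⟨⟨0, hT⟩⟩
  refine max_le (ciSup_le fun t => ?_) (by simpa using h ∅)
  obtain ⟨S, hS, hb⟩ := exists_sum_eq_sum_Ici_decr (baseSupply y r) t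
  rw [Finset.sum_sub_distrib, ← hb, sum_Ici_eq_tailSum, ← hS]
  exact h S

lemma gap_nonneg {n T : ℕ} (C : Fin n → Service) (y r : Fin T → ℕ) : 0 ≤ gap C y r :=
  le_max_right _ _

/-- Supply only lowers deficits. The bound does not depend on `r`, which makes the expected gap
finite for every distribution of `R`. -/
lemma gap_le_gap_zero {n T : ℕ} (hT : 1 ≤ T) (C : Fin n → Service) (y r : Fin T → ℕ) :
    gap C y r ≤ gap C (0 : Fin T → ℕ) 0 := by
  refine gap_le hT fun S => le_trans ?_ (tailSum_sub_sum_le_gap C 0 0 S)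
  refine sub_le_sub_left (Finset.sum_le_sum fun s _ => ?_) _
  simp only [baseSupply, Pi.zero_apply, Nat.cast_zero, add_zero]
  positivity

lemma sum_gStar_eq_gap {n T : ℕ} (hT : 1 ≤ T) (C : Fin n → Service) (y r : Fin T → ℕ) :
    ∑ t, gStar C y r t = gap C y r := by
  have hd := antitone_demand C T
  refine le_antisymm ?_ (gap_le hT fun S => ?_)
  · obtain ⟨S, hS⟩ := exists_sum_leastPurchase_eq hd (baseSupply y r)
    exact hS.trans_le (tailSum_sub_sum_le_gap C y r S)
  · have h1 := tailSum_card_le_sum_leastPurchase hd (baseSupply y r) S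
    have h2 := Finset.sum_le_sum_of_subset_of_nonneg (Finset.subset_univ S)
      fun t _ _ => leastPurchase_nonneg hd (baseSupply y r) t
    rw [Finset.sum_add_distrib] at h1
    simp only [gStar]
    linarith

lemma Meets.gap_le_sum {n T : ℕ} (hT : 1 ≤ T) {C : Fin n → Service}
    (hC : ∀ i, (C i).energy ≤ (C i).rate * T) {y r : Fin T → ℕ} {a : Fin T → ℝ}
    {u : Fin n → Fin T → ℕ} (ha : ∀ t, 0 ≤ a t)
    (hu : Meets C (fun t => baseSupply y r t + a t) u) : gap C y r ≤ ∑ t, a t := by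
  refine gap_le hT fun S => ?_
  have h1 := hu.tailSum_le hC S
  have h2 := Finset.sum_le_sum_of_subset_of_nonneg (Finset.subset_univ S) fun t _ _ => ha t
  rw [Finset.sum_add_distrib] at h1
  linarith

lemma causal_gStar {n T : ℕ} (C : Fin n → Service) (y : Fin T → ℕ) : Causal (gStar C y) :=
  fun t r r' h => leastPurchase_congr _ t fun s hs => by simp only [baseSupply, h s hs]

lemma exists_nat_gStar {n T : ℕ} (C : Fin n → Service) (y r : Fin T → ℕ) (t : Fin T) :
    ∃ k : ℕ, gStar C y r t = k :=
  exists_nat_leastPurchase (antitone_demand C T) (fun _ => ⟨_, (Int.cast_natCast _).symm⟩)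
    (fun t => ⟨(y t : ℤ) + r t, by simp [baseSupply]⟩) t

lemma IsLLF.meets_gStar {n T : ℕ} {C : Fin n → Service}
    (hC : ∀ i, (C i).energy ≤ (C i).rate * T) {y r : Fin T → ℕ} {ν : UnitIndex C → Fin T → ℕ}
    (hν : IsLLF (unitEnergy C) (fun t => baseSupply y r t + gStar C y r t) ν) :
    Meets C (fun t => baseSupply y r t + gStar C y r t) (bundle ν) := by
  -- Integrality matters: the analysis of least-laxity-first needs a supply of whole units.
  choose k hk using exists_nat_gStar C y r
  have hq : (fun t => baseSupply y r t + gStar C y r t) =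
      fun t => ((y t + r t + k t : ℕ) : ℝ) := by
    ext t
    simp [baseSupply, hk]
  have h := tailSum_card_le_sum_leastPurchase (antitone_demand C T) (baseSupply y r)
  change ∀ S : Finset (Fin T), tailSum (demand C T) S.card ≤
    ∑ s ∈ S, (fun t => baseSupply y r t + gStar C y r t) s at h
  rw [hq] at hν h ⊢
  exact hν.meets_bundle hC h

lemma causal_llf_gStar {n T : ℕ} (C : Fin n → Service) (y : Fin T → ℕ) (j : UnitIndex C) :
    Causal fun r => llf (unitEnergy C) (fun t => baseSupply y r t + gStar C y r t) j :=
  fun t r r' h => llf_congr _ t (fun s hs => by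
    rw [causal_gStar C y s r r' fun s' hs' => h s' (hs'.trans hs)]
    simp only [baseSupply, h s hs]) j

lemma admissible_gStar {Ω : Type*} [MeasurableSpace Ω] (P : Measure Ω) {n T : ℕ}
    {C : Fin n → Service} (hC : ∀ i, (C i).energy ≤ (C i).rate * T) (y : Fin T → ℕ)
    (R : Ω → Fin T → ℕ) {ν : (Fin T → ℕ) → UnitIndex C → Fin T → ℕ}
    (hν : ∀ r, IsLLF (unitEnergy C) (fun t => baseSupply y r t + gStar C y r t) (ν r))
    (hc : ∀ j, Causal fun r => ν r j) :
    Admissible P C y R (gStar C y) (fun r => bundle (ν r)) where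
  causal_purchase := causal_gStar C y
  nonneg_purchase _ t := leastPurchase_nonneg (antitone_demand C T) _ t
  causal_allocation i t r r' h := Finset.sum_congr rfl fun j _ => hc ⟨i, j⟩ t r r' h
  meets := ae_of_all _ fun ω => (hν (R ω)).meets_gStar hC

lemma expectedCost_gStar_eq_optimalCost {Ω : Type*} [MeasurableSpace Ω] (P : Measure Ω)
    {n T : ℕ} (hT : 1 ≤ T) {C : Fin n → Service} (hC : ∀ i, (C i).energy ≤ (C i).rate * T)
    (y : Fin T → ℕ) (R : Ω → Fin T → ℕ) (c : ℝ) :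
    expectedCost P c R (gStar C y) = optimalCost P c C y R := by
  refine le_antisymm (le_sInf ?_) (sInf_le ⟨_, _, admissible_gStar P hC y R
    (fun _ => isLLF_llf _ _) (causal_llf_gStar C y), rfl⟩)
  rintro _ ⟨g, h, hgh, rfl⟩
  refine mul_le_mul_right (lintegral_mono_ae ?_) _
  -- The lower bound holds realization by realization, so causality of the competing policies plays
  -- no role.
  filter_upwards [hgh.meets] with ω hω
  rw [sum_gStar_eq_gap hT]
  exact ENNReal.ofReal_le_ofReal (hω.gap_le_sum hT hC (hgh.nonneg_purchase _))

lemma integrable_gap {Ω : Type*} [MeasurableSpace Ω] (P : Measure Ω) [IsFiniteMeasure P]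
    {n T : ℕ} (hT : 1 ≤ T) (C : Fin n → Service) (y : Fin T → ℕ) {R : Ω → Fin T → ℕ}
    (hR : Measurable R) : Integrable (fun ω => gap C y (R ω)) P := by
  have hm : Measurable fun ω => gap C y (R ω) := (measurable_of_countable (gap C y)).comp hR
  refine Integrable.of_bound hm.aestronglyMeasurable (gap C (0 : Fin T → ℕ) 0)
    (ae_of_all _ fun ω => ?_)
  rw [Real.norm_of_nonneg (gap_nonneg C y _)]
  exact gap_le_gap_zero hT C y _

end RateService
theorem theorem3 {Ω : Type*} [MeasurableSpace Ω] (P : MeasureTheory.Measure Ω)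
    [MeasureTheory.IsProbabilityMeasure P] {n T : ℕ} (hT : 1 ≤ T)
    (C : Fin n → RateService.Service) (hC : ∀ i, (C i).energy ≤ (C i).rate * T)
    (y : Fin T → ℕ) (R : Ω → Fin T → ℕ) (hR : Measurable R) (c : ℝ) (hc : 0 ≤ c) :
    -- the policy g* is well defined, causal, and buys nonnegative integer amounts
    (∀ (r : Fin T → ℕ) (t : Fin T),
      IsLeast {x : ℝ | 0 ≤ x ∧ RateService.WeakMaj
          (RateService.lastEntries (RateService.demand C T) t)
          (RateService.partialSupply (RateService.baseSupply y r) (RateService.gStar C y r) t x)}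
        (RateService.gStar C y r t) ∧
      ((t : ℕ) = 0 →
        RateService.gStar C y r t = max (RateService.demand C T (Fin.rev t) - y t - r t) 0) ∧
      ∃ k : ℕ, RateService.gStar C y r t = k) ∧
    RateService.Causal (RateService.gStar C y) ∧
    -- the total supply weakly dominates the demand-duration vector
    (∀ r : Fin T → ℕ, RateService.WeakMaj (RateService.demand C T)
      (fun t => RateService.baseSupply y r t + RateService.gStar C y r t)) ∧
    -- any least-laxity-first allocation works, and a causal one exists
    (∀ (r : Fin T → ℕ) (ν : RateService.UnitIndex C → Fin T → ℕ),
      RateService.IsLLF (RateService.unitEnergy C)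
        (fun t => RateService.baseSupply y r t + RateService.gStar C y r t) ν →
      RateService.Meets C (fun t => RateService.baseSupply y r t + RateService.gStar C y r t)
        (RateService.bundle ν)) ∧
    (∃ ν : (Fin T → ℕ) → RateService.UnitIndex C → Fin T → ℕ,
      (∀ r, RateService.IsLLF (RateService.unitEnergy C)
        (fun t => RateService.baseSupply y r t + RateService.gStar C y r t) (ν r)) ∧
      ∀ j, RateService.Causal fun r => ν r j) ∧
    -- total purchase, lower bound, optimality, optimal value
    (∀ r : Fin T → ℕ, ∑ t, RateService.gStar C y r t = RateService.gap C y r) ∧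
    (∀ (r : Fin T → ℕ) (a : Fin T → ℝ) (u : Fin n → Fin T → ℕ), (∀ t, 0 ≤ a t) →
      RateService.Meets C (fun t => RateService.baseSupply y r t + a t) u →
      RateService.gap C y r ≤ ∑ t, a t) ∧
    (∀ ν : (Fin T → ℕ) → RateService.UnitIndex C → Fin T → ℕ,
      (∀ r, RateService.IsLLF (RateService.unitEnergy C)
        (fun t => RateService.baseSupply y r t + RateService.gStar C y r t) (ν r)) →
      (∀ j, RateService.Causal fun r => ν r j) →
      RateService.Admissible P C y R (RateService.gStar C y)
        (fun r => RateService.bundle (ν r))) ∧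
    RateService.expectedCost P c R (RateService.gStar C y) =
      RateService.optimalCost P c C y R ∧
    MeasureTheory.Integrable (fun ω => RateService.gap C y (R ω)) P ∧
    RateService.optimalCost P c C y R =
      ENNReal.ofReal (c * ∫ ω, RateService.gap C y (R ω) ∂P) := by
  have hd := RateService.antitone_demand C T
  have hcost := RateService.expectedCost_gStar_eq_optimalCost P hT hC y R c
  refine ⟨fun r t => ⟨(RateService.leastPurchase_spec hd _ t).1, fun ht => ?_,
      RateService.exists_nat_gStar C y r t⟩,
    RateService.causal_gStar C y,
    fun r => (RateService.weakMaj_iff hd).2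
      (RateService.tailSum_card_le_sum_leastPurchase hd (RateService.baseSupply y r)),
    fun r ν hν => hν.meets_gStar hC,
    ⟨_, fun r => RateService.isLLF_llf _ _, RateService.causal_llf_gStar C y⟩,
    RateService.sum_gStar_eq_gap hT C y,
    fun r a u ha hu => hu.gap_le_sum hT hC ha,
    fun ν hν hcausal => RateService.admissible_gStar P hC y R hν hcausal,
    hcost, RateService.integrable_gap P hT C y hR, ?_⟩
  · rw [sub_sub]
    exact RateService.leastPurchase_of_val_eq_zero hd _ t ht
  · rw [← hcost, RateService.expectedCost, ENNReal.ofReal_mul hc,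
      MeasureTheory.ofReal_integral_eq_lintegral_ofReal (RateService.integrable_gap P hT C y hR)
        (MeasureTheory.ae_of_all _ fun ω => RateService.gap_nonneg C y (R ω))]
    simp only [RateService.sum_gStar_eq_gap hT]
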